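/- Let $d\ge 1$. For $n_1,\dots,n_d\in\mathbb N$, equip the space $\bigotimes_{j=1}^d\mathbb R^{n_j}$ of real $n_1\times\dots\times n_d$ tensors with the Frobenius inner product $\langle A,B\rangle_F=\sum_{i_1,\dots,i_d} a_{i_1\dots i_d}b_{i_1\dots i_d}$ and the norm $\|A\|_F=\sqrt{\langle A,A\rangle_F}$. A rank-one tensor is a nonzero tensor of the form $x^{(1)}\otimes\dots\otimes x^{(d)}$. Define the spectral norm and the nuclear norm by $$\|A\|_2=\max_{\|x^{(1)}\|=\dots=\|x^{(d)}\|=1}\langle A,x^{(1)}\otimes\dots\otimes x^{(d)}\rangle_F,$$ $$\|A\|_*=\inf\Big\{\sum_{\ell=1}^r\|Y_\ell\|_F:\ A=\sum_{\ell=1}^rY_\ell,\ r\in\mathbb N,\ Y_1,\dots,Y_r\text{ of rank one}\Big\}.$$ Let $\mathrm{Sym}^d(\mathbb R^n)\subset\bigotimes_{j=1}^d\mathbb R^n$ be the subspace of tensors whose entries are invariant under all permutations of the $d$ indices, with the induced inner product. For a Lipschitz function $f:V\to\mathbb R$ on a finite-dimensional Euclidean space $V$, the generalized gradient $\partial f(p)$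 is the convex hull of the set of all limits $\lim_i\nabla f(p_i)$, where $(p_i)$ is a sequence of points of differentiability of $f$ converging to $p$. Let $V$ be $\bigotimes_{j=1}^d\mathbb R^{n_j}$ or $\mathrm{Sym}^d(\mathbb R^n)$, and let $f:V\to\mathbb R$, $f(B)=\|B\|_2$, be the spectral norm regarded as a function on $V$ only. A nonzero $A\in V$ is called critical in $V$ if $A/\|A\|_F$ is a critical point of the restriction of $f$ to the Frobenius unit sphere of $V$, that is, if $\lambda A\in\partial f(A/\|A\|_F)$ for some $\lambda\in\mathbb R$. **Theorem.** Let $V$ be $\bigotimes_{j=1}^d\mathbb R^{n_j}$ or $\mathrm{Sym}^d(\mathbb R^n)$. For every nonzero $A\in V$, the following are equivalent: (i) $A$ is critical in $V$; (ii) $\|A\|_2\,\|A\|_*=\|A\|_F^2$. -/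

import Mathlib

open Filter Topology

noncomputable section

namespace TensorCrit

/-- The space of real `(n₁, …, n_d)`-tensors: tables of real numbers `A i` indexed by multi-indices
`i = (i₁, …, i_d)`. Its inner product and norm are the Frobenius inner product and norm. -/
abbrev Tensor {d : ℕ} (n : Fin d → ℕ) : Type :=
  EuclideanSpace ℝ (∀ j : Fin d, Fin (n j))

/-- The outer product `x⁽¹⁾ ⊗ ⋯ ⊗ x⁽ᵈ⁾`. -/
def outer {d : ℕ} {n : Fin d → ℕ} (x : ∀ j : Fin d, EuclideanSpace ℝ (Fin (n j))) : Tensor n :=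
  WithLp.toLp 2 (fun i => ∏ j : Fin d, x j (i j))

/-- Rank-one tensors: the nonzero outer products. -/
def IsRankOne {d : ℕ} {n : Fin d → ℕ} (Y : Tensor n) : Prop :=
  Y ≠ 0 ∧ ∃ x : ∀ j : Fin d, EuclideanSpace ℝ (Fin (n j)), Y = outer x

/-- The spectral norm: the maximum of `⟨A, x⁽¹⁾ ⊗ ⋯ ⊗ x⁽ᵈ⁾⟩` over unit vectors `x⁽ʲ⁾`. -/
def spectralNorm {d : ℕ} {n : Fin d → ℕ} (A : Tensor n) : ℝ :=
  sSup {t : ℝ | ∃ x : ∀ j : Fin d, EuclideanSpace ℝ (Fin (n j)),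
    (∀ j, ‖x j‖ = 1) ∧ t = inner ℝ A (outer x)}

/-- The nuclear norm: the infimum of `∑ ‖Y_ℓ‖` over all finite decompositions `A = ∑ Y_ℓ` into
rank-one tensors. -/
def nuclearNorm {d : ℕ} {n : Fin d → ℕ} (A : Tensor n) : ℝ :=
  sInf {t : ℝ | ∃ (r : ℕ) (Y : Fin r → Tensor n),
    (∀ l, IsRankOne (Y l)) ∧ A = ∑ l, Y l ∧ t = ∑ l, ‖Y l‖}

/-- The space `Sym^d(ℝⁿ)` of symmetric tensors, a subspace of the space of `(n, …, n)`-tensors, with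
the induced Frobenius inner product. -/
def SymTensor (d n : ℕ) : Submodule ℝ (Tensor (fun _ : Fin d => n)) where
  carrier := {A | ∀ (σ : Equiv.Perm (Fin d)) (i : Fin d → Fin n), A (fun j => i (σ j)) = A i}
  zero_mem' := fun _ _ => rfl
  add_mem' := fun {A B} hA hB σ i => by
    have h1 := hA σ i
    have h2 := hB σ i
    simp only [PiLp.add_apply, h1, h2]
  smul_mem' := fun c A hA σ i => by
    have h1 := hA σ i
    simp only [PiLp.smul_apply, h1]

instance (d n : ℕ) : CompleteSpace (SymTensor d n) :=
  FiniteDimensional.complete ℝ (SymTensor d n)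

section Clarke

variable {E : Type*} [NormedAddCommGroup E] [InnerProductSpace ℝ E] [CompleteSpace E]

/-- The (Clarke) generalized gradient of `f` at `p`: the convex hull of all limits of gradients
`∇f(pᵢ)` along sequences `pᵢ → p` of points at which `f` is differentiable. -/
def generalizedGradient (f : E → ℝ) (p : E) : Set E :=
  convexHull ℝ {v : E | ∃ (q g : ℕ → E), (∀ i, HasGradientAt f (g i) (q i)) ∧
    Tendsto q atTop (𝓝 p) ∧ Tendsto g atTop (𝓝 v)}

/-- `p` is a critical point of the restriction of `f` to the unit sphere of `E`: the generalized
gradient of `f` at `p` meets the normal space `{μ p : μ ∈ ℝ}` of the sphere at `p`. -/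
def IsCriticalOnSphere (f : E → ℝ) (p : E) : Prop :=
  ‖p‖ = 1 ∧ ∃ μ : ℝ, μ • p ∈ generalizedGradient f p

end Clarke

/-- `A` is critical in the space of all `(n₁, …, n_d)`-tensors. -/
def IsCritical {d : ℕ} {n : Fin d → ℕ} (A : Tensor n) : Prop :=
  IsCriticalOnSphere (fun B : Tensor n => spectralNorm B) (‖A‖⁻¹ • A)

/-- `A` is critical in `Sym^d(ℝⁿ)`: here the spectral norm is a function on `Sym^d(ℝⁿ)` only, and
the generalized gradient and the sphere are taken inside that space. -/
def IsCriticalSym {d n : ℕ} (A : SymTensor d n) : Prop :=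
  IsCriticalOnSphere
    (fun B : SymTensor d n => spectralNorm (B : Tensor (fun _ : Fin d => n))) (‖A‖⁻¹ • A)

end TensorCrit

end

/-! Let K be the compact set of unit rank-one tensors. The spectral norm f is the support function
of K, and the generalized gradient of a support function at p is the face of conv K exposed by p
(`mem_generalizedGradient_iff`). Pairing μp with the unit vector p forces μ = f(p), so A is critical
iff (f(A)/‖A‖²)A lies in conv K.

The nuclear norm is the gauge of conv K: rescaling turns rank-one decompositions of A into convex
combinations and back. Pairing A with a decomposition gives ‖A‖² ≤ ‖A‖₂‖A‖_*, and the hull condition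
says exactly that equality holds (`smul_mem_convexHull_iff`).

On symmetric tensors K is replaced by its symmetrization. Since K is invariant under index
permutations, the new hull is conv K ∩ Sym, so the criterion is the same, with the nuclear norm of
the full tensor space. -/

namespace TensorCrit

/-! ### Generalized gradients of support functions -/

section SupportFunction

/-- In a finite-dimensional real space, the convex hull of a compact set is compact. -/
theorem isCompact_convexHull {E : Type*} [NormedAddCommGroup E] [NormedSpace ℝ E]
    [FiniteDimensional ℝ E] {K : Set E} (hK : IsCompact K) : IsCompact (convexHull ℝ K) := by
  -- Carathéodory: at most dim E + 1 points suffice, so the hull is a finite union of continuous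
  -- images of compact sets.
  have key : convexHull ℝ K = ⋃ k ∈ Set.Iio (Module.finrank ℝ E + 2),
      (fun p : (Fin k → ℝ) × (Fin k → E) => ∑ i, p.1 i • p.2 i) ''
        (stdSimplex ℝ (Fin k) ×ˢ Set.univ.pi fun _ => K) := by
    ext x
    simp only [Set.mem_iUnion, Set.mem_image, Set.mem_prod, Set.mem_univ_pi, Prod.exists,
      Set.mem_Iio]
    constructor
    · intro hx
      obtain ⟨ι, _, z, w, hz, haff, hw0, hw1, hx⟩ := eq_pos_convex_span_of_mem_convexHull hx
      have hcard := haff.card_le_finrank_succ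
      have hfr : Module.finrank ℝ (vectorSpan ℝ (Set.range z)) ≤ Module.finrank ℝ E :=
        Submodule.finrank_le _
      refine ⟨Fintype.card ι, by omega, w ∘ (Fintype.equivFin ι).symm,
        z ∘ (Fintype.equivFin ι).symm, ⟨⟨fun i => (hw0 _).le, ?_⟩, fun i => hz ⟨_, rfl⟩⟩, ?_⟩
      · rw [← hw1]
        exact (Fintype.equivFin ι).symm.sum_comp w
      · rw [← hx]
        exact (Fintype.equivFin ι).symm.sum_comp fun i => w i • z i
    · rintro ⟨k, -, w, z, ⟨hw, hz⟩, rfl⟩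
      exact mem_convexHull_of_exists_fintype w z hw.1 hw.2 hz rfl
  rw [key]
  refine (Set.finite_Iio _).isCompact_biUnion fun k _ => ?_
  exact ((isCompact_stdSimplex ℝ (Fin k)).prod (isCompact_univ_pi fun _ => hK)).image
    (by fun_prop)

variable {E : Type*} [NormedAddCommGroup E] [InnerProductSpace ℝ E]

/-- `f` is the support function of `K`, and the supremum is attained everywhere. -/
structure IsSupportFunction (f : E → ℝ) (K : Set E) : Prop where
  inner_le : ∀ x, ∀ k ∈ K, inner ℝ x k ≤ f x
  exists_eq : ∀ x, ∃ k ∈ K, f x = inner ℝ x k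

namespace IsSupportFunction

variable {f : E → ℝ} {K : Set E}

theorem inner_le_of_mem_convexHull (hf : IsSupportFunction f K) (x : E) {v : E}
    (hv : v ∈ convexHull ℝ K) : inner ℝ x v ≤ f x := by
  refine convexHull_min (t := {v | innerSL ℝ x v ≤ f x}) (fun k hk => hf.inner_le x k hk) ?_ hv
  exact convex_halfSpace_le (innerSL ℝ x).toLinearMap.isLinear _

theorem exists_lipschitzWith (hf : IsSupportFunction f K) (hK : IsCompact K) :
    ∃ C, LipschitzWith C f := by
  obtain ⟨M, hM⟩ := hK.isBounded.exists_norm_le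
  refine ⟨M.toNNReal, LipschitzWith.of_le_add_mul _ fun x y => ?_⟩
  obtain ⟨k, hk, hx⟩ := hf.exists_eq x
  have h1 : inner ℝ x k = inner ℝ y k + inner ℝ (x - y) k := by
    rw [inner_sub_left]; ring
  have h2 := hf.inner_le y k hk
  have h3 : inner ℝ (x - y) k ≤ M.toNNReal * dist x y := by
    rw [dist_eq_norm, mul_comm]
    exact (real_inner_le_norm _ _).trans
      (mul_le_mul_of_nonneg_left ((hM k hk).trans (Real.le_coe_toNNReal M)) (norm_nonneg _))
  linarith

variable [CompleteSpace E]

/-- The gradient of a support function at `q` is the point of `K` that exposes `q`. -/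
theorem gradient_mem (hf : IsSupportFunction f K) {q g : E} (h : HasGradientAt f g q) :
    g ∈ K ∧ inner ℝ q g = f q := by
  obtain ⟨k, hk, hq⟩ := hf.exists_eq q
  -- The difference f - ⟨k, ·⟩ is nonnegative and vanishes at q.
  have hmin : IsLocalMin (fun x => f x - innerSL ℝ k x) q := by
    refine Filter.Eventually.of_forall fun x => ?_
    have := hf.inner_le x k hk
    simp only [innerSL_apply_apply]
    rw [hq, real_inner_comm x k, real_inner_comm q k]
    linarith
  have hd := hmin.hasFDerivAt_eq_zero (h.hasFDerivAt.sub (innerSL ℝ k).hasFDerivAt)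
  have hgk : g = k := by
    refine ext_inner_right ℝ fun v => ?_
    have := DFunLike.congr_fun hd v
    simpa [sub_eq_zero] using this
  rw [hgk]
  exact ⟨hk, hq.symm⟩

variable [FiniteDimensional ℝ E]

theorem dense_differentiable (hf : IsSupportFunction f K) (hK : IsCompact K) :
    Dense {q | ∃ g, HasGradientAt f g q} := by
  borelize E
  obtain ⟨C, hC⟩ := hf.exists_lipschitzWith hK
  have hd : Dense {q | DifferentiableAt ℝ f q} :=
    -- Rademacher's theorem.
    MeasureTheory.Measure.dense_of_ae (μ := MeasureTheory.volume) hC.ae_differentiableAt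
  exact hd.mono fun q hq => ⟨_, hq.hasGradientAt⟩

/-- The generalized gradient of a support function at `p` is the face of the convex hull
exposed by `p`. -/
theorem mem_generalizedGradient_iff (hf : IsSupportFunction f K) (hK : IsCompact K) (p v : E) :
    v ∈ generalizedGradient f p ↔ v ∈ convexHull ℝ K ∧ inner ℝ p v = f p := by
  obtain ⟨C, hC⟩ := hf.exists_lipschitzWith hK
  set S : Set E := {v : E | ∃ (q g : ℕ → E), (∀ i, HasGradientAt f (g i) (q i)) ∧
    Tendsto q atTop (𝓝 p) ∧ Tendsto g atTop (𝓝 v)} with hS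
  have hSK : S ⊆ {v | v ∈ K ∧ inner ℝ p v = f p} := by
    rintro v ⟨q, g, hqg, hq, hg⟩
    refine ⟨hK.isClosed.mem_of_tendsto hg (Eventually.of_forall fun i =>
      (hf.gradient_mem (hqg i)).1), ?_⟩
    have h1 : Tendsto (fun i => inner ℝ (q i) (g i)) atTop (𝓝 (inner ℝ p v)) := hq.inner hg
    have h2 : Tendsto (fun i => f (q i)) atTop (𝓝 (f p)) :=
      (hC.continuous.tendsto p).comp hq
    refine tendsto_nhds_unique h1 (h2.congr fun i => (hf.gradient_mem (hqg i)).2.symm)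
  change v ∈ convexHull ℝ S ↔ _
  constructor
  · intro hv
    refine ⟨convexHull_mono (fun v hv => (hSK hv).1) hv, ?_⟩
    refine convexHull_min (t := {v | innerSL ℝ p v = f p}) (fun k hk => (hSK hk).2) ?_ hv
    exact convex_hyperplane (innerSL ℝ p).toLinearMap.isLinear _
  · rintro ⟨hvK, hvp⟩
    by_contra hv
    have hSclosed : IsClosed S := by
      -- The limiting gradients at p form the slice over p of the closure of the graph of ∇f.
      have : S = (fun v => (p, v)) ⁻¹' closure {x : E × E | HasGradientAt f x.2 x.1} := by
        ext w
        rw [Set.mem_preimage, mem_closure_iff_seq_limit]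
        constructor
        · rintro ⟨q, g, h1, h2, h3⟩
          exact ⟨fun i => (q i, g i), h1, h2.prodMk_nhds h3⟩
        · rintro ⟨x, h1, h2⟩
          exact ⟨fun i => (x i).1, fun i => (x i).2, h1, (continuous_fst.tendsto _).comp h2,
            (continuous_snd.tendsto _).comp h2⟩
      rw [this]
      exact isClosed_closure.preimage (by fun_prop)
    have hScomp : IsCompact S := hK.of_isClosed_subset hSclosed fun v hv => (hSK hv).1
    -- Some direction h separates v strictly from all limiting gradients; gradients taken while
    -- approaching p along h will contradict this.
    obtain ⟨l, u, hl, hu⟩ := geometric_hahn_banach_closed_point (convex_convexHull ℝ S)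
      (isCompact_convexHull hScomp).isClosed hv
    obtain ⟨h, rfl⟩ := (InnerProductSpace.toDual ℝ E).surjective l
    simp only [InnerProductSpace.toDual_apply_apply] at hl hu
    -- differentiability points approaching `p` in the direction `h`
    have hex : ∀ i : ℕ, ∃ z g : E, HasGradientAt f g (p + (1 / ((i : ℝ) + 1)) • z) ∧
        dist z h < 1 / ((i : ℝ) + 1) := by
      intro i
      have ht : (0 : ℝ) < 1 / ((i : ℝ) + 1) := by positivity
      set t : ℝ := 1 / ((i : ℝ) + 1)
      -- Accuracy t² leaves an error below t in the direction after division by t.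
      obtain ⟨q, ⟨g, hg⟩, hq⟩ := (hf.dense_differentiable hK).exists_dist_lt (p + t • h)
        (mul_pos ht ht)
      refine ⟨t⁻¹ • (q - p), g, ?_, ?_⟩
      · rwa [smul_inv_smul₀ ht.ne', add_sub_cancel]
      · have e : t⁻¹ • (q - p) - h = t⁻¹ • (q - (p + t • h)) := by
          rw [← sub_sub, smul_sub t⁻¹ (q - p), inv_smul_smul₀ ht.ne']
        rw [dist_eq_norm, e, norm_smul, norm_inv, Real.norm_of_nonneg ht.le, ← dist_eq_norm,
          inv_mul_lt_iff₀ ht, dist_comm]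
        exact hq
    choose z g hg hz using hex
    have ht0 : Tendsto (fun i : ℕ => 1 / ((i : ℝ) + 1)) atTop (𝓝 0) :=
      tendsto_one_div_add_atTop_nhds_zero_nat
    have hzh : Tendsto z atTop (𝓝 h) :=
      tendsto_iff_dist_tendsto_zero.2
        (squeeze_zero (fun _ => dist_nonneg) (fun i : ℕ => (hz i).le) ht0)
    obtain ⟨w, -, φ, hφ, hgw⟩ := hK.tendsto_subseq fun i => (hf.gradient_mem (hg i)).1
    have hwS : w ∈ S := by
      refine ⟨_, _, fun i => hg (φ i), ?_, hgw⟩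
      have : Tendsto (fun i : ℕ => p + (1 / ((i : ℝ) + 1)) • z i) atTop (𝓝 (p + (0 : ℝ) • h)) :=
        tendsto_const_nhds.add (ht0.smul hzh)
      rw [zero_smul, add_zero] at this
      exact this.comp hφ.tendsto_atTop
    -- The gradient g maximizes the pairing with p + tz over conv K, while v already maximizes the
    -- pairing with p; the difference is t⟨z, g - v⟩ ≥ 0 at least.
    have hle : ∀ i, inner ℝ (z i) v ≤ inner ℝ (z i) (g i) := by
      intro i
      have ht : (0 : ℝ) < 1 / ((i : ℝ) + 1) := by positivity
      obtain ⟨hgK, hgf⟩ := hf.gradient_mem (hg i)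
      have h1 := hf.inner_le_of_mem_convexHull (p + (1 / ((i : ℝ) + 1)) • z i) hvK
      have h2 := hf.inner_le p _ hgK
      rw [← hgf, inner_add_left, inner_add_left, real_inner_smul_left, real_inner_smul_left,
        hvp] at h1
      exact le_of_mul_le_mul_left (by linarith) ht
    have hlim : inner ℝ h v ≤ inner ℝ h w :=
      le_of_tendsto_of_tendsto' ((hzh.comp hφ.tendsto_atTop).inner tendsto_const_nhds)
        ((hzh.comp hφ.tendsto_atTop).inner hgw) fun i => hle (φ i)
    linarith [hl w (subset_convexHull ℝ S hwS)]

/-- Criticality on the sphere, for a support function. -/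
theorem isCriticalOnSphere_iff (hf : IsSupportFunction f K) (hK : IsCompact K) {A : E}
    (hA : A ≠ 0) :
    IsCriticalOnSphere f (‖A‖⁻¹ • A) ↔ (f A / ‖A‖ ^ 2) • A ∈ convexHull ℝ K := by
  have hn : 0 < ‖A‖ := norm_pos_iff.2 hA
  -- Support functions are positively homogeneous.
  have hfs : f (‖A‖⁻¹ • A) = ‖A‖⁻¹ * f A := by
    apply le_antisymm
    · obtain ⟨k, hk, h⟩ := hf.exists_eq (‖A‖⁻¹ • A)
      rw [h, real_inner_smul_left]
      exact mul_le_mul_of_nonneg_left (hf.inner_le A k hk) (by positivity)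
    · obtain ⟨k, hk, h⟩ := hf.exists_eq A
      rw [h, ← real_inner_smul_left]
      exact hf.inner_le _ k hk
  have hin : ∀ μ : ℝ, inner ℝ (‖A‖⁻¹ • A) (μ • ‖A‖⁻¹ • A) = μ := by
    intro μ
    rw [real_inner_smul_right, real_inner_self_eq_norm_sq, norm_smul, norm_inv, norm_norm,
      inv_mul_cancel₀ hn.ne']
    ring
  have hsm : (f A / ‖A‖ ^ 2) • A = (‖A‖⁻¹ * f A) • ‖A‖⁻¹ • A := by
    rw [smul_smul]
    congr 1
    field_simp
  constructor
  · rintro ⟨-, μ, hμ⟩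
    rw [hf.mem_generalizedGradient_iff hK, hin, hfs] at hμ
    rw [hsm, ← hμ.2]
    exact hμ.1
  · intro h
    refine ⟨by rw [norm_smul, norm_inv, norm_norm, inv_mul_cancel₀ hn.ne'], ‖A‖⁻¹ * f A, ?_⟩
    rw [hf.mem_generalizedGradient_iff hK, hin, hfs]
    exact ⟨hsm ▸ h, rfl⟩

end IsSupportFunction

end SupportFunction

/-! ### Unit rank-one tensors and the spectral norm -/

section Tensors

variable {d : ℕ} {n : Fin d → ℕ}

@[simp]
theorem outer_apply (x : ∀ j, EuclideanSpace ℝ (Fin (n j))) (i : ∀ j, Fin (n j)) :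
    outer x i = ∏ j, x j (i j) := rfl

theorem norm_outer (x : ∀ j, EuclideanSpace ℝ (Fin (n j))) : ‖outer x‖ = ∏ j, ‖x j‖ := by
  rw [← sq_eq_sq₀ (norm_nonneg _) (Finset.prod_nonneg fun _ _ => norm_nonneg _),
    EuclideanSpace.norm_sq_eq, ← Finset.prod_pow]
  simp only [EuclideanSpace.norm_sq_eq, outer_apply, norm_prod, ← Finset.prod_pow]
  rw [Finset.prod_univ_sum, Fintype.piFinset_univ]

theorem outer_smul (c : Fin d → ℝ) (x : ∀ j, EuclideanSpace ℝ (Fin (n j))) :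
    outer (fun j => c j • x j) = (∏ j, c j) • outer x := by
  ext i
  simp [Finset.prod_mul_distrib]

theorem continuous_outer :
    Continuous (outer : (∀ j, EuclideanSpace ℝ (Fin (n j))) → Tensor n) := by
  unfold outer
  fun_prop

/-- The set of rank-one tensors of norm one. -/
def unitRankOne (n : Fin d → ℕ) : Set (Tensor n) :=
  outer '' {x | ∀ j, ‖x j‖ = 1}

theorem isCompact_unitRankOne : IsCompact (unitRankOne n) := by
  have : {x : ∀ j, EuclideanSpace ℝ (Fin (n j)) | ∀ j, ‖x j‖ = 1} =
      Set.univ.pi fun _ => Metric.sphere 0 1 := by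
    ext x
    simp
  rw [unitRankOne, this]
  exact (isCompact_univ_pi fun _ => isCompact_sphere _ _).image continuous_outer

theorem norm_of_mem_unitRankOne {k : Tensor n} (hk : k ∈ unitRankOne n) : ‖k‖ = 1 := by
  obtain ⟨x, hx, rfl⟩ := hk
  rw [norm_outer]
  exact Finset.prod_eq_one fun j _ => hx j

theorem single_mem_unitRankOne (i : ∀ j, Fin (n j)) :
    EuclideanSpace.single i (1 : ℝ) ∈ unitRankOne n := by
  refine ⟨fun j => EuclideanSpace.single (i j) 1, fun j => by simp, ?_⟩
  ext i'
  simp only [outer_apply, PiLp.single_apply]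
  by_cases h : i' = i
  · simp [h]
  · obtain ⟨j, hj⟩ := Function.ne_iff.1 h
    rw [if_neg h]
    exact Finset.prod_eq_zero (Finset.mem_univ j) (if_neg hj)

theorem IsRankOne.normalize_mem {Y : Tensor n} (hY : IsRankOne Y) :
    ‖Y‖⁻¹ • Y ∈ unitRankOne n := by
  obtain ⟨h0, x, rfl⟩ := hY
  have hx : ∀ j, ‖x j‖ ≠ 0 := by
    have := norm_ne_zero_iff.2 h0
    rw [norm_outer] at this
    exact fun j => Finset.prod_ne_zero_iff.1 this j (Finset.mem_univ j)
  refine ⟨fun j => ‖x j‖⁻¹ • x j, fun j => ?_, ?_⟩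
  · rw [norm_smul, norm_inv, norm_norm, inv_mul_cancel₀ (hx j)]
  · rw [outer_smul, norm_outer, Finset.prod_inv_distrib]

/-- The scalar is absorbed into the first factor, which exists because d ≥ 1. The second clause
keeps unit vectors unit when c = -1. -/
theorem exists_outer_smul (hd : 1 ≤ d) (c : ℝ) (x : ∀ j, EuclideanSpace ℝ (Fin (n j))) :
    ∃ e : Fin d → ℝ, c • outer x = outer (fun j => e j • x j) ∧ ∀ j, e j = c ∨ e j = 1 := by
  refine ⟨fun j => if j = ⟨0, hd⟩ then c else 1, ?_, fun j => ?_⟩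
  · rw [outer_smul]
    simp
  · dsimp only
    split_ifs <;> simp

theorem isRankOne_smul (hd : 1 ≤ d) {k : Tensor n} (hk : k ∈ unitRankOne n) {c : ℝ}
    (hc : c ≠ 0) : IsRankOne (c • k) := by
  have h1 := norm_of_mem_unitRankOne hk
  refine ⟨smul_ne_zero hc (norm_ne_zero_iff.1 (by rw [h1]; exact one_ne_zero)), ?_⟩
  obtain ⟨x, -, rfl⟩ := hk
  obtain ⟨e, he, -⟩ := exists_outer_smul hd c x
  exact ⟨_, he⟩

theorem neg_mem_unitRankOne (hd : 1 ≤ d) {k : Tensor n} (hk : k ∈ unitRankOne n) :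
    -k ∈ unitRankOne n := by
  obtain ⟨x, hx, rfl⟩ := hk
  obtain ⟨e, he, he'⟩ := exists_outer_smul hd (-1) x
  refine ⟨_, fun j => ?_, by rw [← he, neg_one_smul]⟩
  rcases he' j with h | h <;> simp [h, hx j]

/-- Rank-one tensors are nonzero by definition, so terms with zero coefficient must be dropped from
a decomposition. -/
theorem sum_subtype_ne_zero {ι M : Type*} [Fintype ι] [AddCommMonoid M] (w : ι → ℝ) (g : ι → M)
    (hg : ∀ i, w i = 0 → g i = 0) : ∑ i : {i // w i ≠ 0}, g i.1 = ∑ i, g i := by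
  rw [← Finset.sum_subtype (Finset.univ.filter fun i => w i ≠ 0) (by simp) g]
  exact Finset.sum_filter_of_ne fun i _ hi hw => hi (hg i hw)

/-- A nonzero tensor has a nonzero entry. -/
theorem exists_apply_ne_zero {A : Tensor n} (hA : A ≠ 0) : ∃ i, A i ≠ 0 := by
  by_contra! h
  exact hA (by ext i; simpa using h i)

theorem isSupportFunction_spectralNorm (hne : (unitRankOne n).Nonempty) :
    IsSupportFunction (fun B : Tensor n => spectralNorm B) (unitRankOne n) := by
  have hset : ∀ A : Tensor n, spectralNorm A =
      sSup ((fun k => inner ℝ A k) '' unitRankOne n) := by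
    intro A
    unfold spectralNorm unitRankOne
    congr 1
    ext t
    constructor
    · rintro ⟨x, hx, rfl⟩
      exact ⟨_, ⟨x, hx, rfl⟩, rfl⟩
    · rintro ⟨_, ⟨x, hx, rfl⟩, rfl⟩
      exact ⟨x, hx, rfl⟩
  have hcomp : ∀ A : Tensor n, IsCompact ((fun k => inner ℝ A k) '' unitRankOne n) := fun A =>
    isCompact_unitRankOne.image (by fun_prop)
  constructor
  · intro A k hk
    rw [hset]
    exact le_csSup (hcomp A).bddAbove ⟨k, hk, rfl⟩
  · intro A
    obtain ⟨k, hk, h⟩ := (hcomp A).sSup_mem (hne.image _)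
    exact ⟨k, hk, (hset A).trans h.symm⟩

theorem spectralNorm_pos (hd : 1 ≤ d) {A : Tensor n} (hA : A ≠ 0) : 0 < spectralNorm A := by
  obtain ⟨i, hi⟩ := exists_apply_ne_zero hA
  have hmem := single_mem_unitRankOne i
  have hs := isSupportFunction_spectralNorm ⟨_, hmem⟩
  have h1 := hs.inner_le A _ hmem
  have h2 := hs.inner_le A _ (neg_mem_unitRankOne hd hmem)
  simp only [inner_neg_right, EuclideanSpace.inner_single_right] at h1 h2
  rcases lt_or_gt_of_ne hi with h | h
  · have : 0 < -(1 * A i) := by linarith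
    exact this.trans_le h2
  · have : 0 < 1 * A i := by linarith
    exact this.trans_le h1

/-! ### The nuclear norm as the gauge of the convex hull -/

/-- The total norms of the decompositions of `A` into rank-one tensors. -/
def decompositionNorms (A : Tensor n) : Set ℝ :=
  {t : ℝ | ∃ (r : ℕ) (Y : Fin r → Tensor n),
    (∀ l, IsRankOne (Y l)) ∧ A = ∑ l, Y l ∧ t = ∑ l, ‖Y l‖}

theorem sum_mem_decompositionNorms {ι : Type*} [Fintype ι] {Y : ι → Tensor n}
    (hY : ∀ l, IsRankOne (Y l)) : ∑ l, ‖Y l‖ ∈ decompositionNorms (∑ l, Y l) := by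
  refine ⟨Fintype.card ι, Y ∘ (Fintype.equivFin ι).symm, fun l => hY _, ?_, ?_⟩
  · exact ((Fintype.equivFin ι).symm.sum_comp Y).symm
  · exact ((Fintype.equivFin ι).symm.sum_comp fun l => ‖Y l‖).symm

theorem decompositionNorms_nonempty (hd : 1 ≤ d) (A : Tensor n) :
    (decompositionNorms A).Nonempty := by
  have hA : A = ∑ i : {i // A i ≠ 0}, A i.1 • EuclideanSpace.single i.1 (1 : ℝ) := by
    rw [sum_subtype_ne_zero (fun i => A i) (fun i => A i • EuclideanSpace.single i (1 : ℝ))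
      fun i hi => by simp [hi]]
    ext i
    simp [Pi.single_apply]
  rw [hA]
  exact ⟨_, sum_mem_decompositionNorms fun i => isRankOne_smul hd (single_mem_unitRankOne i.1) i.2⟩

/-- Pair A with each term: ⟨A, Y⟩ ≤ ‖A‖₂‖Y‖. -/
theorem sq_norm_le_of_mem_decompositionNorms {A : Tensor n} {t : ℝ}
    (hne : (unitRankOne n).Nonempty) (ht : t ∈ decompositionNorms A) :
    ‖A‖ ^ 2 ≤ spectralNorm A * t := by
  obtain ⟨r, Y, hY, hA, rfl⟩ := ht
  have : ‖A‖ ^ 2 = ∑ l, inner ℝ A (Y l) := by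
    rw [← inner_sum, ← hA, real_inner_self_eq_norm_sq]
  rw [this, Finset.mul_sum]
  refine Finset.sum_le_sum fun l _ => ?_
  have h := (isSupportFunction_spectralNorm hne).inner_le A _ (hY l).normalize_mem
  have hpos := norm_pos_iff.2 (hY l).1
  rw [real_inner_smul_right, inv_mul_le_iff₀ hpos] at h
  rwa [mul_comm] at h

theorem inv_smul_mem_convexHull_of_mem_decompositionNorms {A : Tensor n} {t : ℝ} (ht0 : 0 < t)
    (ht : t ∈ decompositionNorms A) : t⁻¹ • A ∈ convexHull ℝ (unitRankOne n) := by
  obtain ⟨r, Y, hY, rfl, rfl⟩ := ht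
  refine mem_convexHull_of_exists_fintype (fun l => (∑ l, ‖Y l‖)⁻¹ * ‖Y l‖)
    (fun l => ‖Y l‖⁻¹ • Y l) (fun l => by positivity) ?_ (fun l => (hY l).normalize_mem) ?_
  · rw [← Finset.mul_sum, inv_mul_cancel₀ ht0.ne']
  · rw [Finset.smul_sum]
    refine Finset.sum_congr rfl fun l _ => ?_
    rw [smul_smul, mul_assoc, mul_inv_cancel₀ (norm_ne_zero_iff.2 (hY l).1), mul_one]

/-- The weights of a convex combination sum to 1 and its points have norm 1, so division by c gives
total norm exactly 1/c. -/
theorem inv_mem_decompositionNorms (hd : 1 ≤ d) {A : Tensor n} {c : ℝ} (hc : 0 < c)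
    (h : c • A ∈ convexHull ℝ (unitRankOne n)) : c⁻¹ ∈ decompositionNorms A := by
  obtain ⟨ι, _, w, z, hw0, hw1, hz, hA⟩ := mem_convexHull_iff_exists_fintype.1 h
  have key := sum_mem_decompositionNorms (Y := fun i : {i // w i ≠ 0} => (c⁻¹ * w i.1) • z i.1)
    fun i => isRankOne_smul hd (hz i.1) (mul_ne_zero (inv_ne_zero hc.ne') i.2)
  rw [sum_subtype_ne_zero w (fun i => (c⁻¹ * w i) • z i) (fun i hi => by simp [hi]),
    sum_subtype_ne_zero w (fun i => ‖(c⁻¹ * w i) • z i‖) (fun i hi => by simp [hi])] at key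
  have h1 : ∑ i, (c⁻¹ * w i) • z i = A := by
    simp only [mul_smul]
    rw [← Finset.smul_sum, hA, inv_smul_smul₀ hc.ne']
  have h2 : ∑ i, ‖(c⁻¹ * w i) • z i‖ = c⁻¹ := by
    have : ∀ i, ‖(c⁻¹ * w i) • z i‖ = c⁻¹ * w i := fun i => by
      rw [norm_smul, norm_of_mem_unitRankOne (hz i), mul_one,
        Real.norm_of_nonneg (mul_nonneg (inv_nonneg.2 hc.le) (hw0 i))]
    rw [Finset.sum_congr rfl fun i _ => this i, ← Finset.mul_sum, hw1, mul_one]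
  rwa [h1, h2] at key

/-- Membership yields a decomposition attaining the lower bound ‖A‖²/‖A‖₂. Conversely, under
equality the coefficient is 1/‖A‖_*, and closedness of the hull handles the infimum without assuming
it is attained. -/
theorem smul_mem_convexHull_iff (hd : 1 ≤ d) {A : Tensor n} (hA : A ≠ 0) :
    (spectralNorm A / ‖A‖ ^ 2) • A ∈ convexHull ℝ (unitRankOne n) ↔
      spectralNorm A * nuclearNorm A = ‖A‖ ^ 2 := by
  have hs := spectralNorm_pos hd hA
  have hn : 0 < ‖A‖ := norm_pos_iff.2 hA
  have hne : (unitRankOne n).Nonempty :=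
    ⟨_, single_mem_unitRankOne (exists_apply_ne_zero hA).choose⟩
  have hlow : ∀ t ∈ decompositionNorms A, ‖A‖ ^ 2 / spectralNorm A ≤ t := fun t ht => by
    rw [div_le_iff₀ hs, mul_comm]
    exact sq_norm_le_of_mem_decompositionNorms hne ht
  have hglb : IsGLB (decompositionNorms A) (nuclearNorm A) :=
    isGLB_csInf (decompositionNorms_nonempty hd A) ⟨_, hlow⟩
  have hge : ‖A‖ ^ 2 / spectralNorm A ≤ nuclearNorm A := hglb.2 hlow
  constructor
  · intro h
    have hmem := inv_mem_decompositionNorms hd (by positivity) h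
    rw [inv_div] at hmem
    rw [le_antisymm (hglb.1 hmem) hge]
    field_simp
  · intro h
    have hpos : 0 < nuclearNorm A := lt_of_lt_of_le (by positivity) hge
    have hc : spectralNorm A / ‖A‖ ^ 2 = (nuclearNorm A)⁻¹ := by
      rw [← h]
      field_simp
    obtain ⟨u, -, -, hu, hmem⟩ :=
      hglb.exists_seq_antitone_tendsto (decompositionNorms_nonempty hd A)
    rw [hc]
    refine (isCompact_convexHull isCompact_unitRankOne).isClosed.mem_of_tendsto
      ((hu.inv₀ hpos.ne').smul_const A) (Eventually.of_forall fun i => ?_)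
    exact inv_smul_mem_convexHull_of_mem_decompositionNorms (hpos.trans_le (hglb.1 (hmem i)))
      (hmem i)

theorem isCritical_iff (hd : 1 ≤ d) {A : Tensor n} (hA : A ≠ 0) :
    IsCritical A ↔ spectralNorm A * nuclearNorm A = ‖A‖ ^ 2 := by
  have hne : (unitRankOne n).Nonempty :=
    ⟨_, single_mem_unitRankOne (exists_apply_ne_zero hA).choose⟩
  rw [IsCritical, (isSupportFunction_spectralNorm hne).isCriticalOnSphere_iff
    isCompact_unitRankOne hA, smul_mem_convexHull_iff hd hA]

end Tensors

/-! ### Symmetrization and the symmetric case -/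

section Symmetric

variable {d n : ℕ}

/-- Permutation of the indices of a tensor. -/
noncomputable def permIndices (σ : Equiv.Perm (Fin d)) :
    Tensor (fun _ : Fin d => n) ≃ₗᵢ[ℝ] Tensor (fun _ : Fin d => n) :=
  LinearIsometryEquiv.piLpCongrLeft 2 ℝ ℝ (Equiv.arrowCongr σ (Equiv.refl (Fin n)))

theorem permIndices_apply (σ : Equiv.Perm (Fin d)) (A : Tensor (fun _ : Fin d => n))
    (i : Fin d → Fin n) : permIndices σ A i = A (fun j => i (σ j)) := rfl

theorem permIndices_eq_self (σ : Equiv.Perm (Fin d)) (A : SymTensor d n) :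
    permIndices σ (A : Tensor (fun _ : Fin d => n)) = A := by
  ext i
  exact A.2 σ i

theorem permIndices_mem_unitRankOne (σ : Equiv.Perm (Fin d)) {k : Tensor (fun _ : Fin d => n)}
    (hk : k ∈ unitRankOne _) : permIndices σ k ∈ unitRankOne (fun _ : Fin d => n) := by
  obtain ⟨x, hx, rfl⟩ := hk
  refine ⟨fun j => x (σ.symm j), fun j => hx _, ?_⟩
  ext i
  rw [permIndices_apply, outer_apply, outer_apply, ← Equiv.prod_comp σ fun j => x (σ.symm j) (i j)]
  exact Finset.prod_congr rfl fun j _ => by rw [σ.symm_apply_apply]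

theorem card_perm_ne_zero : (Fintype.card (Equiv.Perm (Fin d)) : ℝ) ≠ 0 :=
  Nat.cast_ne_zero.2 Fintype.card_ne_zero

theorem sum_permIndices_mem (A : Tensor (fun _ : Fin d => n)) :
    ∑ σ : Equiv.Perm (Fin d), (Fintype.card (Equiv.Perm (Fin d)) : ℝ)⁻¹ • permIndices σ A ∈
      SymTensor d n := by
  intro τ i
  simp only [WithLp.ofLp_sum, Finset.sum_apply, PiLp.smul_apply, permIndices_apply]
  -- Permuting the indices by τ only translates the summation variable to τσ.
  exact Equiv.sum_comp (Equiv.mulLeft τ) fun σ : Equiv.Perm (Fin d) =>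
    (Fintype.card (Equiv.Perm (Fin d)) : ℝ)⁻¹ • A (fun j => i (σ j))

/-- The symmetrization of a tensor: the average over all permutations of the indices. -/
noncomputable def symmetrize : Tensor (fun _ : Fin d => n) →ₗ[ℝ] SymTensor d n where
  toFun A := ⟨_, sum_permIndices_mem A⟩
  map_add' A B := Subtype.ext <| by simp [Finset.sum_add_distrib]
  map_smul' c A := Subtype.ext <| by simp [Finset.smul_sum, smul_comm c]

theorem coe_symmetrize (A : Tensor (fun _ : Fin d => n)) :
    (symmetrize A : Tensor (fun _ : Fin d => n)) = ∑ σ : Equiv.Perm (Fin d),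
      (Fintype.card (Equiv.Perm (Fin d)) : ℝ)⁻¹ • permIndices σ A := rfl

theorem symmetrize_coe (A : SymTensor d n) :
    symmetrize (A : Tensor (fun _ : Fin d => n)) = A := by
  refine Subtype.ext ?_
  rw [coe_symmetrize]
  simp only [permIndices_eq_self]
  rw [Finset.sum_const, Finset.card_univ, ← Nat.cast_smul_eq_nsmul ℝ,
    smul_inv_smul₀ card_perm_ne_zero]

/-- Index permutations are isometries fixing B, so symmetrization acts as the orthogonal projection
onto the symmetric tensors. -/
theorem inner_symmetrize (B : SymTensor d n) (A : Tensor (fun _ : Fin d => n)) :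
    inner ℝ B (symmetrize A) = inner ℝ (B : Tensor (fun _ : Fin d => n)) A := by
  have h : ∀ σ : Equiv.Perm (Fin d),
      inner ℝ (B : Tensor (fun _ : Fin d => n)) (permIndices σ A) = inner ℝ (B : Tensor _) A :=
    fun σ => by
      rw [← LinearIsometryEquiv.inner_map_map (permIndices σ) _ A, permIndices_eq_self]
  rw [Submodule.coe_inner, coe_symmetrize]
  simp only [inner_sum, real_inner_smul_right, h]
  rw [Finset.sum_const, Finset.card_univ, nsmul_eq_mul, mul_inv_cancel_left₀ card_perm_ne_zero]

theorem symmetrize_mem_convexHull {k : Tensor (fun _ : Fin d => n)} (hk : k ∈ unitRankOne _) :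
    (symmetrize k : Tensor (fun _ : Fin d => n)) ∈
      convexHull ℝ (unitRankOne (fun _ : Fin d => n)) := by
  refine mem_convexHull_of_exists_fintype
    (fun _ => (Fintype.card (Equiv.Perm (Fin d)) : ℝ)⁻¹) (fun σ => permIndices σ k)
    (fun _ => by positivity) ?_ (fun σ => permIndices_mem_unitRankOne σ hk)
    (coe_symmetrize k).symm
  rw [Finset.sum_const, Finset.card_univ, nsmul_eq_mul, mul_inv_cancel₀ card_perm_ne_zero]

/-- On symmetric tensors, the spectral norm is the support function of the symmetrized rank-one
tensors. -/
theorem isSupportFunction_spectralNorm_sym (hne : (unitRankOne (fun _ : Fin d => n)).Nonempty) :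
    IsSupportFunction (fun B : SymTensor d n => spectralNorm (B : Tensor (fun _ : Fin d => n)))
      (symmetrize '' unitRankOne (fun _ : Fin d => n)) := by
  have hs := isSupportFunction_spectralNorm hne
  constructor
  · rintro B _ ⟨k, hk, rfl⟩
    rw [inner_symmetrize]
    exact hs.inner_le _ k hk
  · intro B
    obtain ⟨k, hk, h⟩ := hs.exists_eq B
    exact ⟨_, ⟨k, hk, rfl⟩, by rw [inner_symmetrize]; exact h⟩

/-- Symmetrization is linear, so it commutes with convex hulls. It fixes A, and it keeps points of K
in conv K because it averages permuted copies. -/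
theorem mem_convexHull_image_symmetrize_iff (A : SymTensor d n) :
    A ∈ convexHull ℝ (symmetrize '' unitRankOne (fun _ : Fin d => n)) ↔
      (A : Tensor (fun _ : Fin d => n)) ∈ convexHull ℝ (unitRankOne (fun _ : Fin d => n)) := by
  constructor
  · intro h
    have h' := Set.mem_image_of_mem (SymTensor d n).subtype h
    rw [LinearMap.image_convexHull] at h'
    refine convexHull_min ?_ (convex_convexHull ℝ _) h'
    rintro _ ⟨_, ⟨k, hk, rfl⟩, rfl⟩
    exact symmetrize_mem_convexHull hk
  · intro h
    rw [← LinearMap.image_convexHull]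
    exact ⟨A, h, symmetrize_coe A⟩

theorem isCriticalSym_iff (hd : 1 ≤ d) {A : SymTensor d n} (hA : A ≠ 0) :
    IsCriticalSym A ↔ spectralNorm (A : Tensor (fun _ : Fin d => n)) *
      nuclearNorm (A : Tensor (fun _ : Fin d => n)) = ‖A‖ ^ 2 := by
  have hA' : (A : Tensor (fun _ : Fin d => n)) ≠ 0 := fun h => hA (Subtype.ext h)
  have hne : (unitRankOne (fun _ : Fin d => n)).Nonempty :=
    ⟨_, single_mem_unitRankOne (exists_apply_ne_zero hA').choose⟩
  have hcomp : IsCompact (symmetrize '' unitRankOne (fun _ : Fin d => n)) :=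
    isCompact_unitRankOne.image symmetrize.continuous_of_finiteDimensional
  rw [IsCriticalSym, (isSupportFunction_spectralNorm_sym hne).isCriticalOnSphere_iff hcomp hA,
    mem_convexHull_image_symmetrize_iff]
  exact smul_mem_convexHull_iff hd hA'

end Symmetric

end TensorCrit

theorem mainTheorem6 (d : ℕ) (hd : 1 ≤ d) :
    (∀ (n : Fin d → ℕ) (A : TensorCrit.Tensor n), A ≠ 0 →
      (TensorCrit.IsCritical A ↔
        TensorCrit.spectralNorm A * TensorCrit.nuclearNorm A = ‖A‖ ^ 2)) ∧
    (∀ (n : ℕ) (A : TensorCrit.SymTensor d n), A ≠ 0 →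
      (TensorCrit.IsCriticalSym A ↔
        TensorCrit.spectralNorm (A : TensorCrit.Tensor (fun _ : Fin d => n)) *
            TensorCrit.nuclearNorm (A : TensorCrit.Tensor (fun _ : Fin d => n)) =
          ‖A‖ ^ 2)) :=
  ⟨fun _ _ hA => TensorCrit.isCritical_iff hd hA, fun _ _ hA => TensorCrit.isCriticalSym_iff hd hA⟩
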